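/- Let $1\le C<L$ be integers and let $\mu=(\mu_1,\dots,\mu_L)$ be a probability vector with $\mu_1>\mu_2>\cdots>\mu_L\ge 0$. At each time $t=1,2,\dots$ a file $x(t)\in\{1,\dots,L\}$ is requested; the requests are independent with $\mathbb P(x(t)=i)=\mu_i$. A caching algorithm holds a set $C(t)$ of $C$ files at time $t$ and, under partial observation, it sees the request $x(t)$ if $x(t)\in C(t)$ and otherwise learns only that there was a miss. Marginal posterior sampling: set $\alpha_i(1)=\beta_i(1)=1$ for all $i$. At each time $t$, given the past, draw $\hat\mu_i(t)\sim\mathrm{Beta}(\alpha_i(t),\beta_i(t))$, $i=1,\dots,L$, independently of each other and of $x(t)$; let $C(t)$ be the set of indices of the $C$ largest values $\hat\mu_i(t)$; then, for each cached file $i\in C(t)$, increase $\alpha_i$ by $1$ if $x(t)=i$ and increase $\beta_i$ by $1$ if $x(t)\ne i$, and leave the parameters of all files that are not cached unchanged. Let $R(T)=\sum_{t=1}^{T}\bigl(\mathbf 1\{x(t)\in\{1,\dots,C\}\}-\mathbf 1\{x(t)\in C(t)\}\bigr)$ be the regret with respect to always caching the $C$ most popular files, and let $\Delta_{\min}=\mu_C-\mu_{C+1}>0$.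 Then $\mathbb E[R(T)]=O((L-C)\,C\log T)$, with a constant that depends only on $\Delta_{\min}$: there is a function $K$ such that, for all $L$, $C$, $\mu$ as above and all $T\ge 2$, $$\mathbb E[R(T)]\le K(\Delta_{\min})\,(L-C)\,C\,\log T .$$ -/

import Mathlib

open MeasureTheory ProbabilityTheory

noncomputable section

namespace Caching

/-- What happens in one time step: the vector of values sampled by the algorithm, and the file
requested. The library is `Fin L`; index `i : Fin L` is the `(i + 1)`-st most popular file. -/
abbrev Round (L : ℕ) : Type := (Fin L → ℝ) × Fin L

/-- The indices of the `C` largest entries of `v`. Ties are broken in favour of the smaller index,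
so that this set has exactly `min C L` elements. -/
def topC {L : ℕ} (C : ℕ) (v : Fin L → ℝ) : Finset (Fin L) :=
  {i | (Finset.univ.filter fun j => v i < v j ∨ (v j = v i ∧ j < i)).card < C}

/-- The cache content in a round: the files with the `C` largest sampled values. -/
def cache {L : ℕ} (C : ℕ) (r : Round L) : Finset (Fin L) := topC C r.1

/-- Partial observation: the request is seen in the case of a hit only; `none` is a miss. -/
def observation {L : ℕ} (C : ℕ) (r : Round L) : Option (Fin L) :=
  if r.2 ∈ cache C r then some r.2 else none

/-- Round `r` counts as a success for file `i`: `i` is cached and its request is observed. -/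
def IsSuccess {L : ℕ} (C : ℕ) (r : Round L) (i : Fin L) : Prop :=
  i ∈ cache C r ∧ observation C r = some i

/-- Round `r` counts as a failure for file `i`: `i` is cached and no request for it is observed. -/
def IsFailure {L : ℕ} (C : ℕ) (r : Round L) (i : Fin L) : Prop :=
  i ∈ cache C r ∧ observation C r ≠ some i

open Classical in
/-- The numbers of successes and of failures of every file in the rounds `0, …, n`. -/
def counts {L : ℕ} (C n : ℕ) (h : Finset.Iic n → Round L) : Fin L → ℕ × ℕ :=
  fun i => (∑ s, if IsSuccess C (h s) i then 1 else 0, ∑ s, if IsFailure C (h s) i then 1 else 0)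

/-- Independent samples, that of file `i` from the posterior `Beta (1 + successes, 1 + failures)`
of file `i` (the prior is `Beta (1, 1)`). -/
def samplingLaw {L : ℕ} (k : Fin L → ℕ × ℕ) : Measure (Fin L → ℝ) :=
  Measure.pi fun i => betaMeasure (1 + ((k i).1 : ℝ)) (1 + ((k i).2 : ℝ))

instance {L : ℕ} (k : Fin L → ℕ × ℕ) : IsProbabilityMeasure (samplingLaw k) := by
  have : ∀ i, IsProbabilityMeasure (betaMeasure (1 + ((k i).1 : ℝ)) (1 + ((k i).2 : ℝ))) :=
    fun i => isProbabilityMeasureBeta (by positivity) (by positivity)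
  unfold samplingLaw
  infer_instance

/-- One round of the algorithm when the current success and failure counts are `k`: the values are
sampled from the current posteriors, and the request is drawn from `μ` independently of them. -/
def roundKernel {L : ℕ} (μ : PMF (Fin L)) : Kernel (Fin L → ℕ × ℕ) (Round L) where
  toFun k := (samplingLaw k).prod μ.toMeasure
  measurable' := measurable_of_countable _

instance {L : ℕ} (μ : PMF (Fin L)) : IsMarkovKernel (roundKernel μ) :=
  ⟨fun k => by
    change IsProbabilityMeasure ((samplingLaw k).prod μ.toMeasure)
    infer_instance⟩

lemma measurableSet_mem_cache {L : ℕ} (C : ℕ) (i : Fin L) :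
    MeasurableSet {r : Round L | i ∈ cache C r} := by
  have h : {r : Round L | i ∈ cache C r} = (fun r : Round L =>
      ∑ j, if r.1 i < r.1 j ∨ (r.1 j = r.1 i ∧ j < i) then 1 else 0) ⁻¹' Set.Iio C := by
    ext r
    simp only [cache, topC, Finset.card_filter, Finset.mem_filter, Finset.mem_univ, true_and,
      Set.mem_ofPred_eq, Set.mem_preimage, Set.mem_Iio]
  have hv (j : Fin L) : Measurable fun r : Round L => r.1 j :=
    (measurable_pi_apply j).comp measurable_fst
  rw [h]
  refine (Finset.measurable_sum _ fun j _ => Measurable.ite ?_ measurable_const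
    measurable_const) measurableSet_Iio
  exact (measurableSet_lt (hv i) (hv j)).union
    ((measurableSet_eq_fun (hv j) (hv i)).inter (MeasurableSet.const _))

lemma isSuccess_iff {L : ℕ} (C : ℕ) (r : Round L) (i : Fin L) :
    IsSuccess C r i ↔ i ∈ cache C r ∧ r.2 = i := by
  unfold IsSuccess observation
  split_ifs with h <;> grind

lemma isFailure_iff {L : ℕ} (C : ℕ) (r : Round L) (i : Fin L) :
    IsFailure C r i ↔ i ∈ cache C r ∧ r.2 ≠ i := by
  unfold IsFailure observation
  split_ifs with h <;> grind

lemma measurable_counts {L : ℕ} (C n : ℕ) :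
    Measurable (counts C n : (Finset.Iic n → Round L) → Fin L → ℕ × ℕ) := by
  classical
  have hx (i : Fin L) : MeasurableSet {r : Round L | r.2 = i} :=
    measurable_snd (measurableSet_singleton i)
  have hs (i : Fin L) : MeasurableSet {r : Round L | IsSuccess C r i} := by
    simp only [isSuccess_iff]
    exact (measurableSet_mem_cache C i).inter (hx i)
  have hf (i : Fin L) : MeasurableSet {r : Round L | IsFailure C r i} := by
    simp only [isFailure_iff]
    exact (measurableSet_mem_cache C i).inter (hx i).compl
  refine measurable_pi_lambda _ fun i => Measurable.prodMk ?_ ?_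
  · exact Finset.measurable_sum _ fun s _ =>
      Measurable.ite
        ((measurable_pi_apply (X := fun _ => Round L) s) (hs i)) measurable_const measurable_const
  · exact Finset.measurable_sum _ fun s _ =>
      Measurable.ite
        ((measurable_pi_apply (X := fun _ => Round L) s) (hf i)) measurable_const measurable_const

/-- The law of the next round given the rounds `0, …, n`. -/
def nextRound {L : ℕ} (μ : PMF (Fin L)) (C n : ℕ) : Kernel (Finset.Iic n → Round L) (Round L) :=
  (roundKernel μ).comap (counts C n) (measurable_counts C n)

instance {L : ℕ} (μ : PMF (Fin L)) (C n : ℕ) : IsMarkovKernel (nextRound μ C n) := by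
  unfold nextRound
  infer_instance

/-- The law of the infinite sequence of rounds when marginal posterior sampling is run with cache
size `C` against independent requests with popularity profile `μ`. Round `t` here is time
`t + 1`; all counts are zero at the start. -/
def mpsLaw {L : ℕ} (μ : PMF (Fin L)) (C : ℕ) : Measure (ℕ → Round L) :=
  Kernel.trajMeasure (X := fun _ => Round L) (roundKernel μ fun _ => (0, 0)) (nextRound μ C)

/-- Cumulative regret after `T` steps: hits of the cache that always holds the `C` most popular
files, minus hits of the algorithm. -/
def regret {L : ℕ} (C T : ℕ) (ω : ℕ → Round L) : ℝ :=
  ∑ t ∈ Finset.range T,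
    ((if ((ω t).2 : ℕ) < C then 1 else 0) - (if (ω t).2 ∈ cache C (ω t) then 1 else 0))

/-- The gap between the popularities of the `C`-th and the `(C + 1)`-st most popular file. -/
def gap {L : ℕ} (μ : PMF (Fin L)) (C : ℕ) (hCL : C < L) : ℝ :=
  (μ ⟨C - 1, by omega⟩).toReal - (μ ⟨C, hCL⟩).toReal

end Caching

end

/-! Only rounds in which some unpopular file `j` (index at least `C`) is cached can cost regret, so
it suffices to bound, for each such `j`, the expected number of rounds in which it is cached. Fix a
level `y` in the middle of the gap. If `j` is cached, then either its sample exceeds `y`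
(`inflated`), or its sample is at most `y` while some popular file `i` is left out (`displaced`).

Inflated rounds are rare once `j` has been observed about `log T` times: its empirical mean is then
rarely too high, and otherwise the posterior mass above `y` is `O(1/T)` (`sum_measure_inflated_le`).

Displaced rounds are bounded uniformly in `T`. Let `p` be the posterior probability that the sample
of `i` exceeds `y`. Resampling `i` alone shows that, given the past, displacement has probability at
most `1/p - 1` times the probability that `i` is cached (`exceed_mul_samplingLaw_le`). Every round
in which `i` is cached yields a fresh Bernoulli observation of `i`, so the total charge is at most
`∑ₖ E[1/pₖ - 1]`, where `pₖ` is computed from `k` independent observations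
(`sum_lintegral_charge_le`). This series converges (`binomialWeight_mul_inv_exceedProb_le`,
`summable_inverseBound`).

Summing over the `C` popular files `i` and the `L - C` unpopular files `j` gives the bound. -/

noncomputable section

namespace Caching

/-! ### Chernoff-type bounds for binomial weights. -/

section BetaPosterior

open Real Finset

/-- The probability of `a` successes and `b` failures in `a + b` Bernoulli trials with success
probability `q`. -/
def binomialWeight (q : ℝ) (a b : ℕ) : ℝ := (a + b).choose a * q ^ a * (1 - q) ^ b

lemma binomialWeight_nonneg {q : ℝ} (h0 : 0 ≤ q) (h1 : q ≤ 1) (a b : ℕ) :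
    0 ≤ binomialWeight q a b := by
  have : 0 ≤ 1 - q := by linarith
  unfold binomialWeight
  positivity

lemma binomial_term_le {x y : ℝ} (hx : 0 ≤ x) (hy : 0 ≤ y) (a b : ℕ) :
    (a + b).choose a * x ^ a * y ^ b ≤ (x + y) ^ (a + b) := by
  rw [(Commute.all x y).add_pow' (a + b)]
  have h := Finset.single_le_sum (f := fun m : ℕ × ℕ => (a + b).choose m.1 • (x ^ m.1 * y ^ m.2))
    (s := antidiagonal (a + b)) (fun m _ => by positivity) (a := (a, b)) (by simp)
  simpa [mul_assoc] using h

lemma sum_binomialWeight (q : ℝ) (k : ℕ) :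
    ∑ m ∈ antidiagonal k, binomialWeight q m.1 m.2 = 1 := by
  have h := (Commute.all q (1 - q)).add_pow' k
  rw [add_sub_cancel, one_pow] at h
  rw [h]
  refine Finset.sum_congr rfl fun m hm => ?_
  rw [HasAntidiagonal.mem_antidiagonal] at hm
  simp [binomialWeight, hm, mul_assoc]

/-- The left side is one term of the binomial expansion of the moment generating function `(q e^l +
1 - q)^(a+b)`, and `e^l ≤ 1 + l + l²` for `|l| ≤ 1`. Bounding single atoms instead of tails lets the
same estimate serve for Beta densities. -/
lemma binomialWeight_mul_exp_le {q l : ℝ} (h0 : 0 ≤ q) (h1 : q ≤ 1) (hl : |l| ≤ 1) (a b : ℕ) :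
    binomialWeight q a b * exp (l * a) ≤ exp ((a + b) * (q * l + l ^ 2)) := by
  have h := binomial_term_le (x := q * exp l) (y := 1 - q) (by positivity) (by linarith) a b
  have e : binomialWeight q a b * exp (l * a) =
      (a + b).choose a * (q * exp l) ^ a * (1 - q) ^ b := by
    rw [binomialWeight, mul_pow, ← Real.exp_nat_mul, mul_comm l]
    ring
  have h2 : q * exp l + (1 - q) ≤ exp (q * l + l ^ 2) := by
    have h3 := (abs_le.1 (Real.abs_exp_sub_one_sub_id_le hl)).2
    have h4 := Real.add_one_le_exp (q * l + l ^ 2)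
    nlinarith [sq_nonneg l]
  rw [e]
  calc _ ≤ _ := h
    _ ≤ exp (q * l + l ^ 2) ^ (a + b) :=
      pow_le_pow_left₀ (by have := exp_pos l; nlinarith) h2 _
    _ = _ := by rw [← Real.exp_nat_mul]; push_cast; rfl

lemma binomialWeight_le_of_mul_le {q e : ℝ} (h0 : 0 ≤ q) (h1 : q ≤ 1) (he0 : 0 ≤ e) (he1 : e ≤ 1)
    {a b : ℕ} (h : (a + b) * (q + e) ≤ a) :
    binomialWeight q a b ≤ exp (-((a + b : ℕ) * (e ^ 2 / 4))) := by
  -- `l = e / 2` minimises the exponent `(a + b) (l² - l e)`.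
  have h2 := binomialWeight_mul_exp_le (l := e / 2) h0 h1
    (by rw [abs_le]; constructor <;> linarith) a b
  rw [← le_div_iff₀ (exp_pos _), ← Real.exp_sub] at h2
  refine h2.trans (Real.exp_le_exp.2 ?_)
  push_cast
  nlinarith

lemma binomialWeight_le_of_le_mul {q e : ℝ} (h0 : 0 ≤ q) (h1 : q ≤ 1) (he0 : 0 ≤ e) (he1 : e ≤ 1)
    {a b : ℕ} (h : a ≤ (a + b) * (q - e)) :
    binomialWeight q a b ≤ exp (-((a + b : ℕ) * (e ^ 2 / 4))) := by
  have h2 := binomialWeight_mul_exp_le (l := -(e / 2)) h0 h1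
    (by rw [abs_le]; constructor <;> linarith) a b
  rw [← le_div_iff₀ (exp_pos _), ← Real.exp_sub] at h2
  refine h2.trans (Real.exp_le_exp.2 ?_)
  push_cast
  nlinarith

/-- Truncation of the series of `-log (1 - v)` after its quadratic term. -/
lemma one_sub_le_exp {v : ℝ} (h0 : 0 ≤ v) (h1 : v ≤ 1) : 1 - v ≤ exp (-(v + v ^ 2 / 2)) := by
  rcases h1.eq_or_lt with rfl | h1
  · simpa using (exp_pos _).le
  have hs := Real.hasSum_pow_div_log_of_abs_lt_one (x := v) (by rwa [abs_of_nonneg h0])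
  have := sum_le_hasSum (Finset.range 2) (fun i _ => by positivity) hs
  rw [← Real.exp_log (by linarith : 0 < 1 - v)]
  refine Real.exp_le_exp.2 ?_
  simp [Finset.sum_range_succ] at this
  norm_num at this
  linarith

/-- Comparison of the likelihoods of two success probabilities `z < q` on data whose empirical
mean is at most `z`. -/
lemma binomialWeight_le_exp_mul {q z d : ℝ} (hd : 0 ≤ d) (hz : 0 < z) (hzq : z + d ≤ q)
    (hq : q ≤ 1) (hz1 : z < 1) {a b : ℕ} (h : a ≤ z * (a + b)) :
    binomialWeight q a b ≤ exp (-((a + b : ℕ) * (d ^ 2 / 2))) * binomialWeight z a b := by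
  set D := q - z with hD
  -- Chosen so that `1 - q = (1 - z) (1 - v)`.
  set v := D / (1 - z) with hv
  have hz' : 0 < 1 - z := by linarith
  have hD0 : 0 ≤ D := by linarith
  have hv0 : 0 ≤ v := by positivity
  have hv1 : v ≤ 1 := by rw [hv, div_le_one hz']; linarith
  have hvD : (1 - z) * v = D := by rw [hv]; field_simp
  have hDv : D ≤ v := by nlinarith
  have e1 : q ^ a ≤ z ^ a * exp (a * (D / z)) := by
    rw [Real.exp_nat_mul, ← mul_pow]
    refine pow_le_pow_left₀ (by linarith) ?_ _
    have := Real.add_one_le_exp (D / z)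
    have h3 : q = z * (D / z + 1) := by field_simp; linarith
    calc q = z * (D / z + 1) := h3
      _ ≤ _ := by gcongr
  have e2 : (1 - q) ^ b ≤ (1 - z) ^ b * exp (b * -(v + v ^ 2 / 2)) := by
    rw [Real.exp_nat_mul, ← mul_pow]
    refine pow_le_pow_left₀ (by linarith) ?_ _
    have h3 : 1 - q = (1 - z) * (1 - v) := by rw [mul_sub, hvD]; linarith
    rw [h3]
    gcongr
    exact one_sub_le_exp hv0 hv1
  -- The empirical mean being at most `z`, the linear terms satisfy `a D / z ≤ (a + b) D ≤ b v` and
  -- cancel; the quadratic term `b v² / 2` is what remains.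
  have hexp : a * (D / z) + b * -(v + v ^ 2 / 2) ≤ -((a + b : ℕ) * (d ^ 2 / 2)) := by
    have i1 : a * (D / z) ≤ (a + b) * D := by
      rw [← mul_div_assoc, div_le_iff₀ hz]
      nlinarith
    have i2 : (1 - z) * (a + b) ≤ b := by linarith
    have i3 : (a + b) * D ≤ b * v := by
      calc (a + b) * D = (1 - z) * (a + b) * v := by rw [← hvD]; ring
        _ ≤ b * v := by gcongr
    have hab : (0 : ℝ) ≤ a + b := by positivity
    have i4 : (a + b) * d ^ 2 ≤ b * v ^ 2 := by
      calc (a + b) * d ^ 2 ≤ (a + b) * (D * v) := by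
            gcongr
            nlinarith
        _ = ((a + b) * D) * v := by ring
        _ ≤ (b * v) * v := by gcongr
        _ = _ := by ring
    push_cast
    nlinarith
  calc binomialWeight q a b
      ≤ (a + b).choose a * (z ^ a * exp (a * (D / z)))
          * ((1 - z) ^ b * exp (b * -(v + v ^ 2 / 2))) := by
        unfold binomialWeight
        have : 0 ≤ 1 - q := by linarith
        gcongr
    _ = exp (a * (D / z) + b * -(v + v ^ 2 / 2)) * binomialWeight z a b := by
        rw [Real.exp_add, binomialWeight]; ring
    _ ≤ _ := by
        gcongr
        exact binomialWeight_nonneg hz.le hz1.le a b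

/-! ### Beta posteriors with integer counts. -/

lemma one_add_pos (n : ℕ) : (0 : ℝ) < 1 + n := by positivity

lemma one_div_beta_one_add (a b : ℕ) :
    1 / beta (1 + a) (1 + b) = (a + b + 1) * (a + b).choose a := by
  have h := Nat.add_choose_mul_factorial_mul_factorial a b
  rw [← Nat.choose_symm_add] at h
  have h1 : (1 + a + (1 + b) : ℝ) = ((a + b + 1 : ℕ) : ℝ) + 1 := by push_cast; ring
  rw [beta, h1, add_comm (1 : ℝ) a, add_comm (1 : ℝ) b, Real.Gamma_nat_eq_factorial,
    Real.Gamma_nat_eq_factorial, Real.Gamma_nat_eq_factorial, Nat.factorial_succ, ← h]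
  have ha : (a.factorial : ℝ) ≠ 0 := by positivity
  have hb : (b.factorial : ℝ) ≠ 0 := by positivity
  push_cast
  field_simp

/-- Beta–binomial duality: up to the factor `a + b + 1`, the posterior density at `x` is the
likelihood of the data under `x`, so the bounds on weights become bounds on posteriors. -/
lemma betaPDFReal_one_add {x : ℝ} (h0 : 0 < x) (h1 : x < 1) (a b : ℕ) :
    betaPDFReal (1 + a) (1 + b) x = (a + b + 1) * binomialWeight x a b := by
  rw [betaPDFReal, if_pos ⟨h0, h1⟩, one_div_beta_one_add, binomialWeight]
  simp only [add_sub_cancel_left, Real.rpow_natCast]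
  ring

lemma betaMeasure_le {a b : ℕ} {S : Set ℝ} (hS : MeasurableSet S) {c : ℝ}
    (h : ∀ x ∈ S, 0 < x → x < 1 → binomialWeight x a b ≤ c) :
    betaMeasure (1 + a) (1 + b) S ≤ ENNReal.ofReal ((a + b + 1) * c) := by
  rw [betaMeasure, withDensity_apply _ hS]
  calc ∫⁻ x in S, betaPDF (1 + a) (1 + b) x
      ≤ ∫⁻ x in S, (Set.Ioo (0 : ℝ) 1).indicator
          (fun _ => ENNReal.ofReal ((a + b + 1) * c)) x := by
        refine setLIntegral_mono (measurable_const.indicator measurableSet_Ioo) fun x hx => ?_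
        by_cases hx1 : x ∈ Set.Ioo (0 : ℝ) 1
        · rw [Set.indicator_of_mem hx1, betaPDF, betaPDFReal_one_add hx1.1 hx1.2]
          refine ENNReal.ofReal_le_ofReal ?_
          gcongr
          exact h x hx hx1.1 hx1.2
        · rw [Set.indicator_of_notMem hx1, betaPDF, betaPDFReal, if_neg (by exact hx1)]
          simp
    _ ≤ ∫⁻ x, (Set.Ioo (0 : ℝ) 1).indicator
          (fun _ => ENNReal.ofReal ((a + b + 1) * c)) x := setLIntegral_le_lintegral _ _
    _ = _ := by
        rw [lintegral_indicator measurableSet_Ioo]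
        simp

/-- The polynomially corrected Chernoff bound for a Beta posterior after `k` observations. -/
def tailBound (d : ℝ) (k : ℕ) : ℝ := (k + 1) * exp (-(k * (d ^ 2 / 4)))

lemma tailBound_nonneg (d : ℝ) (k : ℕ) : 0 ≤ tailBound d k := by unfold tailBound; positivity

lemma betaMeasure_Ioi_le {a b : ℕ} {x y d : ℝ} (hd0 : 0 ≤ d) (hd1 : d ≤ 1) (hxy : x + d ≤ y)
    (h : a ≤ x * (a + b)) :
    betaMeasure (1 + a) (1 + b) (Set.Ioi y) ≤ ENNReal.ofReal (tailBound d (a + b)) := by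
  have := betaMeasure_le (a := a) (b := b) (S := Set.Ioi y) measurableSet_Ioi
    (c := exp (-((a + b : ℕ) * (d ^ 2 / 4)))) (fun z hz hz0 hz1 =>
      binomialWeight_le_of_le_mul hz0.le hz1.le hd0 hd1 (by
        rw [Set.mem_Ioi] at hz
        have : (0 : ℝ) ≤ a + b := by positivity
        nlinarith))
  simpa [tailBound] using this

lemma betaMeasure_Iic_le {a b : ℕ} {x y d : ℝ} (hd0 : 0 ≤ d) (hd1 : d ≤ 1) (hxy : y + d ≤ x)
    (h : x * (a + b) ≤ a) :
    betaMeasure (1 + a) (1 + b) (Set.Iic y) ≤ ENNReal.ofReal (tailBound d (a + b)) := by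
  have := betaMeasure_le (a := a) (b := b) (S := Set.Iic y) measurableSet_Iic
    (c := exp (-((a + b : ℕ) * (d ^ 2 / 4)))) (fun z hz hz0 hz1 =>
      binomialWeight_le_of_mul_le hz0.le hz1.le hd0 hd1 (by
        rw [Set.mem_Iic] at hz
        have : (0 : ℝ) ≤ a + b := by positivity
        nlinarith))
  simpa [tailBound] using this

/-- On `(z, 1)` the factor `x ^ a` is at least `z ^ a`, and the remaining `(1 - x) ^ b` integrates
exactly; the leftover factor `(a + b + 1) / (b + 1)` is at least one. -/
lemma le_betaMeasure_Ioi {z : ℝ} (h0 : 0 < z) (h1 : z < 1) (a b : ℕ) :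
    ENNReal.ofReal (binomialWeight z a b * (1 - z)) ≤
      betaMeasure (1 + a) (1 + b) (Set.Ioi z) := by
  rw [betaMeasure, withDensity_apply _ measurableSet_Ioi]
  have hI : ∫⁻ x in Set.Ioc z 1, ENNReal.ofReal
      ((a + b + 1) * ((a + b).choose a * z ^ a) * (1 - x) ^ b) =
      ENNReal.ofReal (∫ x in z..1, (a + b + 1) * ((a + b).choose a * z ^ a) * (1 - x) ^ b) := by
    rw [intervalIntegral.integral_of_le h1.le, ofReal_integral_eq_lintegral_ofReal]
    · have : Continuous fun x : ℝ =>
        ((a : ℝ) + b + 1) * ((a + b).choose a * z ^ a) * (1 - x) ^ b := by fun_prop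
      exact (this.intervalIntegrable z 1).1
    · refine (ae_restrict_iff' measurableSet_Ioc).2 (Filter.Eventually.of_forall fun x hx => ?_)
      have : 0 ≤ 1 - x := by linarith [hx.2]
      simp only [Pi.zero_apply]
      positivity
  have hJ : ∫ x in z..1, (a + b + 1) * ((a + b).choose a * z ^ a) * (1 - x) ^ b =
      (a + b + 1) * ((a + b).choose a * z ^ a) * ((1 - z) ^ (b + 1) / (b + 1)) := by
    rw [intervalIntegral.integral_const_mul, intervalIntegral.integral_comp_sub_left
      (fun x => x ^ b), integral_pow]
    simp
  calc ENNReal.ofReal (binomialWeight z a b * (1 - z))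
      ≤ ENNReal.ofReal ((a + b + 1) * ((a + b).choose a * z ^ a)
          * ((1 - z) ^ (b + 1) / (b + 1))) := by
        refine ENNReal.ofReal_le_ofReal ?_
        have hz' : 0 < 1 - z := by linarith
        have e : (a + b + 1) * ((a + b).choose a * z ^ a) * ((1 - z) ^ (b + 1) / (b + 1)) =
          (((a : ℝ) + b + 1) / (b + 1)) * (binomialWeight z a b * (1 - z)) := by
            rw [binomialWeight]; field_simp; ring
        rw [e]
        refine le_mul_of_one_le_left
          (mul_nonneg (binomialWeight_nonneg h0.le h1.le a b) hz'.le) ?_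
        rw [one_le_div (by positivity)]
        have : (0 : ℝ) ≤ a := by positivity
        linarith
    _ = ∫⁻ x in Set.Ioc z 1, ENNReal.ofReal
          ((a + b + 1) * ((a + b).choose a * z ^ a) * (1 - x) ^ b) := by rw [hI, hJ]
    _ = ∫⁻ x in Set.Ioo z 1, ENNReal.ofReal
          ((a + b + 1) * ((a + b).choose a * z ^ a) * (1 - x) ^ b) := by
        rw [restrict_Ioo_eq_restrict_Ioc]
    _ ≤ ∫⁻ x in Set.Ioo z 1, betaPDF (1 + a) (1 + b) x := by
        refine setLIntegral_mono (measurable_betaPDFReal _ _).ennreal_ofReal fun x hx => ?_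
        rw [betaPDF, betaPDFReal_one_add (h0.trans hx.1) hx.2, binomialWeight]
        refine ENNReal.ofReal_le_ofReal ?_
        have : 0 ≤ 1 - x := by linarith [hx.2]
        rw [mul_assoc]
        gcongr
        exact hx.1.le
    _ ≤ ∫⁻ x in Set.Ioi z, betaPDF (1 + a) (1 + b) x :=
        lintegral_mono_set fun x hx => hx.1

lemma summable_tailBound {d : ℝ} (hd : 0 < d) : Summable (tailBound d) := by
  have hr : 0 < d ^ 2 / 4 := by positivity
  have h0 := Real.summable_pow_mul_exp_neg_nat_mul 0 hr
  have h1 := Real.summable_pow_mul_exp_neg_nat_mul 1 hr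
  refine (h1.add h0).congr fun k => ?_
  rw [tailBound, show -(k * (d ^ 2 / 4)) = -(d ^ 2 / 4) * k by ring]
  ring

lemma summable_linear_mul_exp {r : ℝ} (hr : 0 < r) :
    Summable fun k : ℕ => (k + 1) * exp (-(k * r)) := by
  have h := summable_tailBound (d := 2 * √r) (by positivity)
  refine h.congr fun k => ?_
  rw [tailBound, mul_pow, Real.sq_sqrt hr.le]
  congr 4
  ring

/-! ### Expected inverse exceedance probability after `k` observations. -/

/-- The posterior probability of exceeding `y` after `a` successes and `b` failures. -/
def exceedProb (y : ℝ) (m : ℕ × ℕ) : ℝ := (betaMeasure (1 + m.1) (1 + m.2)).real (Set.Ioi y)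

instance isProbabilityMeasure_betaMeasure_one_add (a b : ℕ) :
    IsProbabilityMeasure (betaMeasure (1 + a) (1 + b)) :=
  isProbabilityMeasureBeta (one_add_pos a) (one_add_pos b)

lemma exceedProb_le_one (y : ℝ) (m : ℕ × ℕ) : exceedProb y m ≤ 1 := measureReal_le_one

lemma binomialWeight_mul_le_exceedProb {y z : ℝ} (hyz : y ≤ z) (h0 : 0 < z) (h1 : z < 1)
    (a b : ℕ) : binomialWeight z a b * (1 - z) ≤ exceedProb y (a, b) := by
  rw [exceedProb, measureReal_def, ← ENNReal.ofReal_le_iff_le_toReal (measure_ne_top _ _)]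
  exact (le_betaMeasure_Ioi h0 h1 a b).trans (measure_mono (Set.Ioi_subset_Ioi hyz))

lemma binomialWeight_pos {z : ℝ} (h0 : 0 < z) (h1 : z < 1) (a b : ℕ) :
    0 < binomialWeight z a b := by
  have : 0 < 1 - z := by linarith
  have : 0 < (a + b).choose a := Nat.choose_pos (by omega)
  unfold binomialWeight
  positivity

lemma exceedProb_pos {y : ℝ} (h0 : 0 < y) (h1 : y < 1) (m : ℕ × ℕ) : 0 < exceedProb y m :=
  (mul_pos (binomialWeight_pos h0 h1 m.1 m.2) (by linarith)).trans_le
    (binomialWeight_mul_le_exceedProb le_rfl h0 h1 m.1 m.2)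

lemma one_sub_tailBound_le_exceedProb {a b : ℕ} {x y d : ℝ} (hd0 : 0 ≤ d) (hd1 : d ≤ 1)
    (hxy : y + d ≤ x) (h : x * (a + b) ≤ a) :
    1 - tailBound d (a + b) ≤ exceedProb y (a, b) := by
  have h1 := betaMeasure_Iic_le hd0 hd1 hxy h
  rw [ENNReal.le_ofReal_iff_toReal_le (measure_ne_top _ _) (tailBound_nonneg _ _)] at h1
  have h2 : (betaMeasure (1 + a) (1 + b)).real (Set.Ioi y) =
      1 - (betaMeasure (1 + a) (1 + b)).real (Set.Iic y) := by
    rw [← Set.compl_Iic, probReal_compl_eq_one_sub measurableSet_Iic]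
  rw [exceedProb]
  simp only
  rw [h2]
  rw [← measureReal_def] at h1
  linarith

/-- A summable bound on the expected inverse exceedance probability, minus one, of a file whose
popularity is bounded away from the threshold. -/
def inverseBound (d : ℝ) (k : ℕ) : ℝ :=
  (k + 1) * exp (-(k * (d ^ 2 / 2))) * d⁻¹ +
    if tailBound d k ≤ 1 / 2 then 2 * tailBound d k else (d ^ (k + 1))⁻¹ * d⁻¹

lemma inverseBound_nonneg {d : ℝ} (hd : 0 < d) (k : ℕ) : 0 ≤ inverseBound d k := by
  have := tailBound_nonneg d k
  unfold inverseBound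
  split_ifs <;> positivity

/-- Since `tailBound d k` tends to zero, the exponentially large `else` branch occurs for finitely
many `k` only. -/
lemma summable_inverseBound {d : ℝ} (hd : 0 < d) : Summable (inverseBound d) := by
  have h := summable_tailBound hd
  refine ((summable_linear_mul_exp (r := d ^ 2 / 2) (by positivity)).mul_right d⁻¹).add ?_
  have hev : ∀ᶠ k in Filter.atTop, tailBound d k ≤ 1 / 2 :=
    h.tendsto_atTop_zero.eventually_le_const (by norm_num)
  refine (h.mul_left 2).congr_atTop ?_
  filter_upwards [hev] with k hk
  rw [if_pos hk]

lemma pow_le_binomialWeight {z d : ℝ} (hd : 0 < d) (h0 : d ≤ z) (h1 : d ≤ 1 - z) (a b : ℕ) :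
    d ^ (a + b) ≤ binomialWeight z a b := by
  have h : (1 : ℝ) ≤ (a + b).choose a := by
    exact_mod_cast Nat.choose_pos (show a ≤ a + b by omega)
  rw [binomialWeight, mul_assoc, pow_add]
  have h2 : d ^ a * d ^ b ≤ z ^ a * (1 - z) ^ b := by
    have : 0 ≤ z := by linarith
    gcongr
  have h3 : 0 ≤ z ^ a * (1 - z) ^ b := le_trans (by positivity) h2
  nlinarith

/-- Split at empirical mean `z = y + d`. Below it, `1/p` may be huge, but `p` is at least the
likelihood of `z` times `1 - z`, and the data are exponentially less likely under `q` than under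
`z`; the likelihoods of `z` cancel. Above it, the posterior is concentrated above `y`, so `1/p - 1`
is of the order of `tailBound`, unless `k` is small, where a crude bound suffices. -/
lemma binomialWeight_mul_inv_exceedProb_le {d y q : ℝ} (hd : 0 < d) (hy : d ≤ y)
    (hyq : y + 2 * d ≤ q) (hq : q ≤ 1) (a b : ℕ) :
    binomialWeight q a b * ((exceedProb y (a, b))⁻¹ - 1) ≤
      exp (-((a + b : ℕ) * (d ^ 2 / 2))) * d⁻¹ + binomialWeight q a b *
        if tailBound d (a + b) ≤ 1 / 2 then 2 * tailBound d (a + b)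
        else (d ^ (a + b + 1))⁻¹ * d⁻¹ := by
  set p := exceedProb y (a, b)
  have hp0 : 0 < p := exceedProb_pos (by linarith) (by linarith) _
  have hz := binomialWeight_mul_le_exceedProb (y := y) (z := y + d) (by linarith) (by linarith)
    (by linarith) a b
  change _ ≤ p at hz
  have hq0 := binomialWeight_nonneg (q := q) (by linarith) hq a b
  have hz0 := binomialWeight_pos (z := y + d) (by linarith) (by linarith) a b
  have hw : binomialWeight (y + d) a b * d ≤ p := by
    refine le_trans ?_ hz
    gcongr
    linarith
  have ht := tailBound_nonneg d (a + b)
  by_cases h : (a : ℝ) ≤ (y + d) * (a + b)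
  · have h1 := binomialWeight_le_exp_mul hd.le (by linarith : 0 < y + d)
      (by linarith : y + d + d ≤ q) hq (by linarith) h
    refine le_trans ?_ (le_add_of_nonneg_right (mul_nonneg hq0 ?_))
    · calc binomialWeight q a b * (p⁻¹ - 1) ≤ binomialWeight q a b * p⁻¹ := by
            gcongr; linarith
        _ ≤ exp (-((a + b : ℕ) * (d ^ 2 / 2))) * binomialWeight (y + d) a b *
              (binomialWeight (y + d) a b * d)⁻¹ := by gcongr
        _ = _ := by field_simp
    · split_ifs <;> positivity
  · refine le_trans ?_ (le_add_of_nonneg_left (by positivity))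
    refine mul_le_mul_of_nonneg_left ?_ hq0
    split_ifs with hs
    · have h1 := one_sub_tailBound_le_exceedProb hd.le (by linarith) le_rfl (not_le.1 h).le
      change _ ≤ p at h1
      have h2 : p⁻¹ ≤ (1 - tailBound d (a + b))⁻¹ := by
        gcongr
        linarith
      have h3 : (1 - tailBound d (a + b))⁻¹ ≤ 1 + 2 * tailBound d (a + b) := by
        rw [inv_le_iff_one_le_mul₀ (by linarith)]
        nlinarith
      linarith
    · have h1 := pow_le_binomialWeight hd (by linarith : d ≤ y + d) (by linarith) a b
      have h2 : d ^ (a + b + 1) * d ≤ p := by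
        refine le_trans ?_ hw
        gcongr
        refine le_trans ?_ h1
        exact pow_le_pow_of_le_one hd.le (by linarith) (by omega)
      have h3 : p⁻¹ ≤ (d ^ (a + b + 1) * d)⁻¹ := by gcongr
      rw [mul_inv] at h3
      linarith

/-- The first term of the pointwise bound occurs once for each of the `k + 1` outcomes; the second
is averaged by weights of total mass one. -/
lemma sum_binomialWeight_mul_inv_exceedProb_le {d y q : ℝ} (hd : 0 < d) (hy : d ≤ y)
    (hyq : y + 2 * d ≤ q) (hq : q ≤ 1) (k : ℕ) :
    ∑ m ∈ antidiagonal k, binomialWeight q m.1 m.2 * ((exceedProb y m)⁻¹ - 1) ≤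
      inverseBound d k := by
  calc _ ≤ ∑ m ∈ antidiagonal k, (exp (-(k * (d ^ 2 / 2))) * d⁻¹ +
        binomialWeight q m.1 m.2 * if tailBound d k ≤ 1 / 2 then 2 * tailBound d k
          else (d ^ (k + 1))⁻¹ * d⁻¹) := by
        refine Finset.sum_le_sum fun m hm => ?_
        rw [HasAntidiagonal.mem_antidiagonal] at hm
        subst hm
        exact binomialWeight_mul_inv_exceedProb_le hd hy hyq hq m.1 m.2
    _ = _ := by
        rw [Finset.sum_add_distrib, ← Finset.sum_mul (a := ite _ _ _), sum_binomialWeight,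
          inverseBound]
        simp [mul_assoc]

lemma sum_binomialWeight_deviation_le {d x q : ℝ} (hd0 : 0 ≤ d) (hd1 : d ≤ 1) (hq0 : 0 ≤ q)
    (hq1 : q ≤ 1) (hx : q + d ≤ x) (k : ℕ) :
    ∑ m ∈ antidiagonal k, binomialWeight q m.1 m.2 *
      (if x * (m.1 + m.2) < m.1 then 1 else 0) ≤ tailBound d k := by
  calc _ ≤ ∑ m ∈ antidiagonal k, exp (-(k * (d ^ 2 / 4))) := by
        refine Finset.sum_le_sum fun m hm => ?_
        rw [HasAntidiagonal.mem_antidiagonal] at hm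
        subst hm
        split_ifs with h
        · rw [mul_one]
          refine binomialWeight_le_of_mul_le hq0 hq1 hd0 hd1 (le_trans ?_ h.le)
          rw [mul_comm]
          gcongr
        · rw [mul_zero]
          positivity
    _ = _ := by simp [tailBound]

/-- Indicator of the data after which a Beta posterior may not yet be concentrated below the
threshold: fewer than `M` observations, or an empirical mean above `x`. -/
def exploring (M : ℕ) (x : ℝ) (m : ℕ × ℕ) : ℝ :=
  if m.1 + m.2 < M ∨ x * (m.1 + m.2) < m.1 then 1 else 0

/-- Each of the first `M` levels contributes at most its total mass one; deviations of the empirical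
mean contribute a convergent series. -/
lemma sum_binomialWeight_mul_exploring_le {d x q : ℝ} (hd0 : 0 < d) (hd1 : d ≤ 1) (hq0 : 0 ≤ q)
    (hq1 : q ≤ 1) (hx : q + d ≤ x) (M n : ℕ) :
    ∑ k ∈ range n, ∑ m ∈ antidiagonal k, binomialWeight q m.1 m.2 * exploring M x m ≤
      M + ∑' k, tailBound d k := by
  have h1 (k : ℕ) : ∑ m ∈ antidiagonal k, binomialWeight q m.1 m.2 * exploring M x m ≤
      (if k < M then 1 else 0) + tailBound d k := by
    calc _ ≤ ∑ m ∈ antidiagonal k, (binomialWeight q m.1 m.2 * (if k < M then 1 else 0) +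
          binomialWeight q m.1 m.2 * (if x * (m.1 + m.2) < m.1 then 1 else 0)) := by
          refine Finset.sum_le_sum fun m hm => ?_
          rw [HasAntidiagonal.mem_antidiagonal] at hm
          rw [exploring, ← mul_add, hm]
          refine mul_le_mul_of_nonneg_left ?_ (binomialWeight_nonneg hq0 hq1 _ _)
          split_ifs <;> first | (norm_num; done) | grind
      _ ≤ _ := by
          rw [Finset.sum_add_distrib, ← Finset.sum_mul, sum_binomialWeight, one_mul]
          gcongr
          exact sum_binomialWeight_deviation_le hd0.le hd1 hq0 hq1 hx k
  calc _ ≤ ∑ k ∈ range n, ((if k < M then 1 else 0) + tailBound d k) :=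
        Finset.sum_le_sum fun k _ => h1 k
    _ ≤ _ := by
        rw [Finset.sum_add_distrib]
        refine add_le_add ?_
          ((summable_tailBound hd0).sum_le_tsum _ fun k _ => tailBound_nonneg d k)
        rw [Finset.sum_boole]
        calc (((range n).filter (· < M)).card : ℝ) ≤ ((range M).card : ℝ) := by
              gcongr
              intro k hk
              simp only [Finset.mem_filter, Finset.mem_range] at hk ⊢
              exact hk.2
          _ = M := by simp

lemma sum_sum_binomialWeight_mul_inv_exceedProb_le {d y q : ℝ} (hd : 0 < d) (hy : d ≤ y)
    (hyq : y + 2 * d ≤ q) (hq : q ≤ 1) (n : ℕ) :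
    ∑ k ∈ range n, ∑ m ∈ antidiagonal k, binomialWeight q m.1 m.2 * ((exceedProb y m)⁻¹ - 1) ≤
      ∑' k, inverseBound d k :=
  (Finset.sum_le_sum fun k _ => sum_binomialWeight_mul_inv_exceedProb_le hd hy hyq hq k).trans
    ((summable_inverseBound hd).sum_le_tsum _ fun k _ => inverseBound_nonneg hd k)

/-- Split the rate `d² / 4` into two halves `d² / 8`: one absorbs the factor `k + 1`, the other
produces `1 / s`. -/
lemma tailBound_le_of_log_le {d s : ℝ} (hd : 0 < d) (hs : 0 < s) {k : ℕ}
    (hk : 8 / d ^ 2 * log s ≤ k) : tailBound d k ≤ (8 / d ^ 2 + 1) / s := by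
  set r := d ^ 2 / 8 with hr
  have hr0 : 0 < r := by positivity
  have h1 : log s ≤ k * r := by
    have : 8 / d ^ 2 = 1 / r := by rw [hr]; field_simp
    rw [this, one_div, inv_mul_le_iff₀ hr0] at hk
    linarith
  have h2 : exp (-(k * r)) ≤ 1 / s := by
    rw [one_div, ← Real.exp_log hs, ← Real.exp_neg, Real.exp_le_exp]
    linarith
  have h3 : (k + 1) * exp (-(k * r)) ≤ 8 / d ^ 2 + 1 := by
    have h4 := Real.add_one_le_exp (k * r)
    have h5 : 8 / d ^ 2 = 1 / r := by rw [hr]; field_simp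
    rw [Real.exp_neg, ← div_eq_mul_inv, div_le_iff₀ (exp_pos _), h5]
    have h6 : (k : ℝ) ≤ 1 / r * exp (k * r) := by
      rw [one_div, inv_mul_eq_div, le_div_iff₀ hr0]
      linarith
    have h7 : 1 ≤ exp (k * r) := Real.one_le_exp (by positivity)
    linarith
  calc tailBound d k = (k + 1) * exp (-(k * r)) * exp (-(k * r)) := by
        rw [tailBound, mul_assoc, ← Real.exp_add]
        congr 2
        rw [hr]; ring
    _ ≤ (8 / d ^ 2 + 1) * (1 / s) := by gcongr
    _ = _ := by ring

end BetaPosterior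

open Finset
open scoped ENNReal

variable {L : ℕ}

/-! ### The ranking by sampled values and the resampling inequality. -/

/-- The files that precede file `i` in the ranking by sampled values. -/
def beaters (v : Fin L → ℝ) (i : Fin L) : Finset (Fin L) :=
  univ.filter fun j => v i < v j ∨ (v j = v i ∧ j < i)

lemma mem_topC {C : ℕ} {v : Fin L → ℝ} {i : Fin L} : i ∈ topC C v ↔ (beaters v i).card < C := by
  simp [topC, beaters]

lemma beaters_ssubset {v : Fin L → ℝ} {i j : Fin L} (h : j ∈ beaters v i) :
    beaters v j ⊂ beaters v i := by
  simp only [beaters, mem_filter, mem_univ, true_and] at h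
  refine Finset.ssubset_iff_of_subset (fun l hl => ?_) |>.2 ⟨j, ?_, ?_⟩
  · simp only [beaters, mem_filter, mem_univ, true_and] at hl ⊢
    grind
  · simpa [beaters] using h
  · simp [beaters]

lemma card_beaters_injective (v : Fin L → ℝ) : Function.Injective fun i => (beaters v i).card := by
  intro i j hij
  by_contra hne
  have : j ∈ beaters v i ∨ i ∈ beaters v j := by
    simp only [beaters, mem_filter, mem_univ, true_and]
    grind
  rcases this with h | h
  · exact (card_lt_card (beaters_ssubset h)).ne' hij
  · exact (card_lt_card (beaters_ssubset h)).ne hij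

lemma card_beaters_lt (v : Fin L → ℝ) (i : Fin L) : (beaters v i).card < L := by
  have h : beaters v i ⊂ univ := by
    refine Finset.ssubset_univ_iff.2 fun h => ?_
    have := h ▸ mem_univ i
    simp [beaters] at this
  simpa using card_lt_card h

/-- The tie-breaking makes the ranking a strict total order, so ranks are distinct and run through
`0, …, L - 1`. -/
lemma card_topC {C : ℕ} (hCL : C ≤ L) (v : Fin L → ℝ) : (topC C v).card = C := by
  have himg : univ.image (fun i => (beaters v i).card) = range L := by
    refine eq_of_subset_of_card_le (fun k hk => ?_) ?_
    · obtain ⟨i, -, rfl⟩ := mem_image.1 hk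
      exact mem_range.2 (card_beaters_lt v i)
    · rw [card_image_of_injective _ (card_beaters_injective v)]
      simp
  have h2 : (topC C v).image (fun i => (beaters v i).card) = range C := by
    ext k
    simp only [mem_image, mem_range, mem_topC]
    constructor
    · rintro ⟨i, hi, rfl⟩
      exact hi
    · intro hk
      have : k ∈ univ.image (fun i => (beaters v i).card) := by
        rw [himg, mem_range]; omega
      obtain ⟨i, -, rfl⟩ := mem_image.1 this
      exact ⟨i, hk, rfl⟩
  rw [← card_image_of_injective _ (card_beaters_injective v), h2, card_range]

lemma card_filter_val_lt {C : ℕ} (hCL : C ≤ L) :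
    (univ.filter fun i : Fin L => (i : ℕ) < C).card = C := by
  rw [Fin.card_filter_val_lt]
  omega

lemma exists_le_mem_topC {C : ℕ} (hCL : C ≤ L) {v : Fin L → ℝ} {i : Fin L} (hi : (i : ℕ) < C)
    (h : i ∉ topC C v) : ∃ j ∈ topC C v, C ≤ (j : ℕ) := by
  by_contra! hcon
  have hsub : topC C v ⊆ univ.filter fun i : Fin L => (i : ℕ) < C := fun j hj => by
    simpa using hcon j hj
  have := eq_of_subset_of_card_le hsub (by rw [card_topC hCL, card_filter_val_lt hCL])
  exact h (this ▸ by simpa using hi)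

lemma exists_lt_notMem_topC {C : ℕ} (hCL : C ≤ L) {v : Fin L → ℝ} {j : Fin L} (hj : C ≤ (j : ℕ))
    (h : j ∈ topC C v) : ∃ i ∉ topC C v, (i : ℕ) < C := by
  by_contra! hcon
  have hsub : (univ.filter fun i : Fin L => (i : ℕ) < C) ⊆ topC C v := fun i hi => by
    by_contra hi'
    have := hcon i hi'
    simp at hi
    omega
  have := eq_of_subset_of_card_le hsub (by rw [card_topC hCL, card_filter_val_lt hCL])
  rw [← this] at h
  simp at h
  omega

/-- Whatever still beats `i` at its raised value also beats `j`, so `i` now ranks no worse than `j`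
did. -/
lemma mem_topC_update {C : ℕ} {v : Fin L → ℝ} {i j : Fin L} {z : ℝ} (hj : j ∈ topC C v)
    (hz : v j < z) : i ∈ topC C (Function.update v i z) := by
  rw [mem_topC] at hj ⊢
  refine lt_of_le_of_lt (card_le_card fun l hl => ?_) hj
  simp only [beaters, mem_filter, mem_univ, true_and, Function.update_self] at hl ⊢
  by_cases hli : l = i
  · subst hli
    simp at hl
  · rw [Function.update_of_ne hli] at hl
    left
    rcases hl with hl | hl
    · linarith
    · linarith [hl.1]

lemma measurableSet_mem_topC (C : ℕ) (i : Fin L) :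
    MeasurableSet {v : Fin L → ℝ | i ∈ topC C v} :=
  (measurable_id.prodMk (measurable_const (a := i))) (measurableSet_mem_cache C i)

/-- If `j` is cached with a value at most `y` and `i` is not cached, then `i` would have been cached
had its sample exceeded `y`. -/
lemma exceed_mul_samplingLaw_le (C : ℕ) (N : Fin L → ℕ × ℕ) (i j : Fin L) (y : ℝ) :
    betaMeasure (1 + (N i).1) (1 + (N i).2) (Set.Ioi y) *
        samplingLaw N {v | j ∈ topC C v ∧ v j ≤ y ∧ i ∉ topC C v} ≤
      betaMeasure (1 + (N i).1) (1 + (N i).2) (Set.Iic y) * samplingLaw N {v | i ∈ topC C v} := by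
  set ν : Fin L → Measure ℝ := fun i => betaMeasure (1 + ((N i).1 : ℝ)) (1 + ((N i).2 : ℝ))
  have hE : MeasurableSet {v : Fin L → ℝ | j ∈ topC C v ∧ v j ≤ y ∧ i ∉ topC C v} :=
    (measurableSet_mem_topC C j).inter
      ((measurableSet_le (measurable_pi_apply j) measurable_const).inter
        (measurableSet_mem_topC C i).compl)
  have hI := measurableSet_mem_topC C i
  change ν i (Set.Ioi y) * Measure.pi ν _ ≤ ν i (Set.Iic y) * Measure.pi ν _
  rw [← lintegral_indicator_one hE, ← lintegral_indicator_one hI,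
    ← lintegral_const_mul _ (measurable_one.indicator hE),
    ← lintegral_const_mul _ (measurable_one.indicator hI)]
  have m1 : Measurable fun v : Fin L → ℝ => ν i (Set.Ioi y) *
      {v : Fin L → ℝ | j ∈ topC C v ∧ v j ≤ y ∧ i ∉ topC C v}.indicator 1 v :=
    (measurable_one.indicator hE).const_mul _
  have m2 : Measurable fun v : Fin L → ℝ => ν i (Set.Iic y) *
      {v : Fin L → ℝ | i ∈ topC C v}.indicator 1 v := (measurable_one.indicator hI).const_mul _
  -- Only coordinate `i` is integrated out; the inequality holds for every fixed choice of the other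
  -- samples.
  refine lintegral_le_of_lmarginal_le {i} m1 m2 ?_
  rw [lmarginal_singleton, lmarginal_singleton]
  intro v
  have hu : Measurable fun z => Function.update v i z := measurable_update v
  have slice_eq (c : ℝ≥0∞) {S : Set (Fin L → ℝ)} (hS : MeasurableSet S) :
      ∫⁻ z, c * S.indicator 1 (Function.update v i z) ∂ν i =
        c * ν i ((fun z => Function.update v i z) ⁻¹' S) := by
    rw [← lintegral_indicator_one (hu hS)]
    exact lintegral_const_mul _ ((measurable_one.indicator hS).comp hu)
  refine ((slice_eq _ hE).trans_le ?_).trans (slice_eq _ hI).ge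
  -- If the slice of the left event is nonempty, `i` is cached for every value above `y`: that slice
  -- lies in `Iic y`, and the slice of the right event contains `Ioi y`.
  by_cases hz : ∃ z, Function.update v i z ∈
      {v : Fin L → ℝ | j ∈ topC C v ∧ v j ≤ y ∧ i ∉ topC C v}
  · obtain ⟨z, hj, hjy, -⟩ := hz
    have key (w : ℝ) (hw : y < w) : i ∈ topC C (Function.update v i w) := by
      have := mem_topC_update (i := i) hj (hjy.trans_lt hw)
      rwa [Function.update_idem] at this
    rw [mul_comm]
    refine mul_le_mul' (measure_mono fun w hw => ?_) (measure_mono fun w hw => key w hw)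
    rw [Set.mem_Iic]
    by_contra hlt
    exact hw.2.2 (key w (not_le.1 hlt))
  · have : (fun z => Function.update v i z) ⁻¹'
        {v : Fin L → ℝ | j ∈ topC C v ∧ v j ≤ y ∧ i ∉ topC C v} = ∅ :=
      Set.eq_empty_of_forall_notMem fun z h => hz ⟨z, h⟩
    rw [this]
    simp

/-! ### The potential of a single file under Bernoulli observations. -/

/-- The counts after a round with outcome `r`, when they were `N` before it. -/
def advance (C : ℕ) (N : Fin L → ℕ × ℕ) (r : Round L) (i : Fin L) : ℕ × ℕ :=
  if i ∈ cache C r then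
    if r.2 = i then ((N i).1 + 1, (N i).2) else ((N i).1, (N i).2 + 1)
  else N i

lemma lintegral_roundKernel (μ : PMF (Fin L)) (N : Fin L → ℕ × ℕ) {g : Round L → ℝ≥0∞}
    (hg : Measurable g) :
    ∫⁻ r, g r ∂roundKernel μ N = ∫⁻ v, ∑ x, μ x * g (v, x) ∂samplingLaw N := by
  change ∫⁻ r, g r ∂((samplingLaw N).prod μ.toMeasure) = _
  rw [lintegral_prod _ hg.aemeasurable]
  refine lintegral_congr fun v => ?_
  rw [lintegral_fintype]
  refine Finset.sum_congr rfl fun x _ => ?_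
  rw [PMF.toMeasure_apply_singleton _ _ (measurableSet_singleton x), mul_comm]

/-- Expectation of `φ` after one more observation of a Bernoulli variable with mean `q`. -/
def observe (q : ℝ≥0∞) : Module.End ℝ≥0∞ (ℕ × ℕ → ℝ≥0∞) :=
  q • LinearMap.funLeft ℝ≥0∞ ℝ≥0∞ (fun m : ℕ × ℕ => (m.1 + 1, m.2)) +
    (1 - q) • LinearMap.funLeft ℝ≥0∞ ℝ≥0∞ (fun m : ℕ × ℕ => (m.1, m.2 + 1))

lemma observe_apply (q : ℝ≥0∞) (φ : ℕ × ℕ → ℝ≥0∞) (m : ℕ × ℕ) :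
    observe q φ m = q * φ (m.1 + 1, m.2) + (1 - q) * φ (m.1, m.2 + 1) := by
  simp [observe, LinearMap.funLeft_apply]

lemma funLeft_pow_apply (f : ℕ × ℕ → ℕ × ℕ) (n : ℕ) (φ : ℕ × ℕ → ℝ≥0∞) (m : ℕ × ℕ) :
    (LinearMap.funLeft ℝ≥0∞ ℝ≥0∞ f ^ n) φ m = φ (f^[n] m) := by
  induction n generalizing m with
  | zero => simp
  | succ n ih =>
    rw [pow_succ', Module.End.mul_apply, LinearMap.funLeft_apply, ih, Function.iterate_succ_apply]

/-- The success and failure shifts commute, so the binomial theorem for operators gives the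
expectation over `k` independent observations. -/
lemma observe_pow_apply_zero (q : ℝ≥0∞) (φ : ℕ × ℕ → ℝ≥0∞) (k : ℕ) :
    (observe q ^ k) φ (0, 0) =
      ∑ m ∈ antidiagonal k, (k.choose m.1 * q ^ m.1 * (1 - q) ^ m.2) * φ m := by
  have hc : Commute (q • LinearMap.funLeft ℝ≥0∞ ℝ≥0∞ (fun m : ℕ × ℕ => (m.1 + 1, m.2)))
      ((1 - q) • LinearMap.funLeft ℝ≥0∞ ℝ≥0∞ (fun m : ℕ × ℕ => (m.1, m.2 + 1))) := by
    refine LinearMap.ext fun ψ => funext fun m => ?_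
    simp [LinearMap.funLeft_apply]
    ring
  rw [observe, hc.add_pow', LinearMap.sum_apply, Finset.sum_apply]
  refine Finset.sum_congr rfl fun m _ => ?_
  have h1 (n : ℕ) (p : ℕ × ℕ) : (fun m : ℕ × ℕ => (m.1 + 1, m.2))^[n] p = (p.1 + n, p.2) := by
    induction n generalizing p with
    | zero => rfl
    | succ n ih => rw [Function.iterate_succ_apply, ih]; ext <;> simp; omega
  have h2 (n : ℕ) (p : ℕ × ℕ) : (fun m : ℕ × ℕ => (m.1, m.2 + 1))^[n] p = (p.1, p.2 + n) := by
    induction n generalizing p with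
    | zero => rfl
    | succ n ih => rw [Function.iterate_succ_apply, ih]; ext <;> simp; omega
  simp [smul_pow, funLeft_pow_apply, h1, h2]
  ring

/-- The expectation of the sum of `φ` over the first `n` states of an independently observed
Bernoulli sequence. -/
def cumulative (q : ℝ≥0∞) (φ : ℕ × ℕ → ℝ≥0∞) (n : ℕ) : ℕ × ℕ → ℝ≥0∞ :=
  ∑ k ∈ range n, (observe q ^ k) φ

lemma cumulative_succ (q : ℝ≥0∞) (φ : ℕ × ℕ → ℝ≥0∞) (n : ℕ) :
    cumulative q φ (n + 1) = φ + observe q (cumulative q φ n) := by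
  rw [cumulative, Finset.sum_range_succ', cumulative, map_sum, add_comm]
  simp [pow_succ', Module.End.mul_apply]

lemma cumulative_le_succ (q : ℝ≥0∞) (φ : ℕ × ℕ → ℝ≥0∞) (n : ℕ) :
    cumulative q φ n ≤ cumulative q φ (n + 1) := by
  rw [cumulative, cumulative, Finset.sum_range_succ]
  exact le_self_add

lemma measurableSet_requested (i : Fin L) : MeasurableSet {r : Round L | r.2 = i} :=
  measurable_snd (measurableSet_singleton i)

lemma measurable_advance (C : ℕ) (N : Fin L → ℕ × ℕ) (i : Fin L) :
    Measurable fun r : Round L => advance C N r i :=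
  Measurable.ite (measurableSet_mem_cache C i)
    (Measurable.ite (measurableSet_requested i) measurable_const measurable_const) measurable_const

lemma sum_mul_ite_eq (μ : PMF (Fin L)) (i : Fin L) (s t : ℝ≥0∞) :
    ∑ x, μ x * (if x = i then s else t) = μ i * s + (1 - μ i) * t := by
  have h1 : ∑ x, μ x = 1 := by rw [← tsum_fintype (L := .unconditional _), μ.tsum_coe]
  have h2 : ∑ x ∈ univ.erase i, μ x = 1 - μ i := by
    rw [← h1, ← Finset.add_sum_erase _ _ (mem_univ i),
      ENNReal.add_sub_cancel_left (μ.apply_ne_top i)]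
  rw [← Finset.add_sum_erase _ _ (mem_univ i), if_pos rfl, ← h2, Finset.sum_mul]
  congr 1
  refine Finset.sum_congr rfl fun x hx => ?_
  rw [if_neg (Finset.ne_of_mem_erase hx)]

/-- The potential `cumulative` decreases in expectation by at least the charge for caching. -/
lemma lintegral_charge_add_cumulative_le (μ : PMF (Fin L)) (C : ℕ) (N : Fin L → ℕ × ℕ)
    (i : Fin L) (φ : ℕ × ℕ → ℝ≥0∞) (n : ℕ) :
    ∫⁻ r, ((if i ∈ cache C r then φ (N i) else 0) + cumulative (μ i) φ n (advance C N r i))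
      ∂roundKernel μ N ≤ cumulative (μ i) φ (n + 1) (N i) := by
  rw [lintegral_roundKernel]
  · calc _ ≤ ∫⁻ _, cumulative (μ i) φ (n + 1) (N i) ∂samplingLaw N := by
          refine lintegral_mono fun v => ?_
          -- When `i` is cached, its counts make one step of `observe` and equality holds; otherwise
          -- they stay put and monotonicity in `n` suffices.
          by_cases hv : i ∈ topC C v
          · have e (x : Fin L) : μ x * ((if i ∈ cache C ((v, x) : Round L) then φ (N i) else 0) +
                cumulative (μ i) φ n (advance C N (v, x) i)) =
                μ x * (if x = i then φ (N i) + cumulative (μ i) φ n ((N i).1 + 1, (N i).2)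
                  else φ (N i) + cumulative (μ i) φ n ((N i).1, (N i).2 + 1)) := by
              simp only [advance, cache, hv, if_true]
              split_ifs <;> rfl
            simp only [e]
            rw [sum_mul_ite_eq, cumulative_succ, Pi.add_apply, observe_apply, mul_add, mul_add,
              add_add_add_comm, ← add_mul, add_tsub_cancel_of_le (μ.coe_le_one i), one_mul]
          · have e (x : Fin L) : μ x * ((if i ∈ cache C ((v, x) : Round L) then φ (N i) else 0) +
                cumulative (μ i) φ n (advance C N (v, x) i)) =
                μ x * cumulative (μ i) φ n (N i) := by
              simp [advance, cache, hv]
            simp only [e]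
            rw [← Finset.sum_mul, ← tsum_fintype (L := .unconditional _), μ.tsum_coe, one_mul]
            exact cumulative_le_succ _ _ _ _
      _ = _ := by simp
  · exact (Measurable.ite (measurableSet_mem_cache C i) measurable_const measurable_const).add
      ((measurable_of_countable _).comp (measurable_advance C N i))

/-! ### The law of the trajectory and the charging argument. -/

/-- The success and failure counts before round `t`. -/
def state (C : ℕ) (ω : ℕ → Round L) : ℕ → Fin L → ℕ × ℕ
  | 0 => fun _ => (0, 0)
  | t + 1 => advance C (state C ω t) (ω t)

open Classical in
lemma state_eq_sum (C : ℕ) (ω : ℕ → Round L) (t : ℕ) (i : Fin L) :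
    state C ω t i = (∑ s ∈ range t, if IsSuccess C (ω s) i then 1 else 0,
      ∑ s ∈ range t, if IsFailure C (ω s) i then 1 else 0) := by
  induction t with
  | zero => simp [state]
  | succ t ih =>
    rw [Finset.sum_range_succ, Finset.sum_range_succ, state, advance, ih]
    simp only [isSuccess_iff, isFailure_iff]
    split_ifs <;> simp_all

lemma state_succ_eq_counts (C n : ℕ) (ω : ℕ → Round L) :
    state C ω (n + 1) = counts C n (Preorder.frestrictLe n ω) := by
  classical
  funext i
  rw [state_eq_sum, counts]
  simp only [Preorder.frestrictLe_apply]
  have e : range (n + 1) = Finset.Iic n := by ext; simp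
  rw [e]
  congr 1
  · exact (Finset.sum_coe_sort (Finset.Iic n) fun s => if IsSuccess C (ω s) i then 1 else 0).symm
  · exact (Finset.sum_coe_sort (Finset.Iic n) fun s => if IsFailure C (ω s) i then 1 else 0).symm

lemma measurable_state (C t : ℕ) : Measurable fun ω : ℕ → Round L => state C ω t := by
  cases t with
  | zero => exact measurable_const
  | succ n =>
    simp only [state_succ_eq_counts]
    exact (measurable_counts C n).comp (Preorder.measurable_frestrictLe n)

instance (μ : PMF (Fin L)) (C : ℕ) : IsProbabilityMeasure (mpsLaw μ C) := by
  unfold mpsLaw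
  infer_instance

lemma map_eval_zero_mpsLaw (μ : PMF (Fin L)) (C : ℕ) :
    (mpsLaw μ C).map (fun ω => ω 0) = roundKernel μ fun _ => (0, 0) := by
  have hf : (fun ω : ℕ → Round L => ω 0) =
      (fun h : Finset.Iic 0 → Round L => h ⟨0, by simp⟩) ∘ Preorder.frestrictLe 0 := rfl
  rw [hf, ← Measure.map_map (by fun_prop) (by fun_prop), mpsLaw, Kernel.trajMeasure,
    Measure.map_comp _ _ (by fun_prop), Kernel.traj_map_frestrictLe, Kernel.partialTraj_self,
    Measure.id_comp, Measure.map_map (by fun_prop) (by fun_prop)]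
  exact Measure.map_id

/-- Given the counts before it, a round is distributed according to `roundKernel`. -/
lemma lintegral_mpsLaw_round (μ : PMF (Fin L)) (C t : ℕ)
    {f : (Fin L → ℕ × ℕ) → Round L → ℝ≥0∞} (hf : ∀ N, Measurable (f N)) :
    ∫⁻ ω, f (state C ω t) (ω t) ∂mpsLaw μ C =
      ∫⁻ ω, ∫⁻ r, f (state C ω t) r ∂roundKernel μ (state C ω t) ∂mpsLaw μ C := by
  have hF : Measurable (Function.uncurry f) := measurable_from_prod_countable_right hf
  cases t with
  | zero =>
    simp only [state, lintegral_const, measure_univ, mul_one]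
    rw [← map_eval_zero_mpsLaw μ C, lintegral_map (hf _) (measurable_pi_apply 0)]
  | succ n =>
    simp only [state_succ_eq_counts]
    have hG : Measurable fun p : (Finset.Iic n → Round L) × Round L => f (counts C n p.1) p.2 :=
      hF.comp (((measurable_counts C n).comp measurable_fst).prodMk measurable_snd)
    have h := Kernel.map_frestrictLe_trajMeasure_compProd_eq_map_trajMeasure
      (X := fun _ => Round L) (μ₀ := roundKernel μ fun _ => (0, 0)) (κ := nextRound μ C) (a := n)
    have hm : Measurable fun x : ℕ → Round L =>
        (Preorder.frestrictLe (π := fun _ => Round L) n x, x (n + 1)) := by fun_prop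
    have h1 := lintegral_map (μ := mpsLaw μ C) hG hm
    rw [mpsLaw, ← h, Measure.lintegral_compProd hG, lintegral_map] at h1
    · exact h1.symm
    · exact hG.lintegral_kernel_prod_right'
    · fun_prop

/-- Charges paid plus remaining potential form a supermartingale. The horizon `n` is left free so
that each round can trade one unit of it. -/
lemma sum_lintegral_add_lintegral_cumulative_le (μ : PMF (Fin L)) (C : ℕ) (i : Fin L)
    (φ : ℕ × ℕ → ℝ≥0∞) (t n : ℕ) :
    ∑ s ∈ range t, ∫⁻ ω, (if i ∈ cache C (ω s) then φ (state C ω s i) else 0) ∂mpsLaw μ C +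
      ∫⁻ ω, cumulative (μ i) φ n (state C ω t i) ∂mpsLaw μ C ≤
      cumulative (μ i) φ (t + n) (0, 0) := by
  induction t generalizing n with
  | zero => simp [state]
  | succ t ih =>
    have hm1 (N : Fin L → ℕ × ℕ) :
        Measurable fun r : Round L => if i ∈ cache C r then φ (N i) else 0 :=
      Measurable.ite (measurableSet_mem_cache C i) measurable_const measurable_const
    have hm2 (N : Fin L → ℕ × ℕ) :
        Measurable fun r : Round L => cumulative (μ i) φ n (advance C N r i) :=
      (measurable_of_countable _).comp (measurable_advance C N i)
    have hm3 : Measurable fun ω : ℕ → Round L =>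
        cumulative (μ i) φ n (state C ω (t + 1) i) :=
      (measurable_of_countable fun N : Fin L → ℕ × ℕ => cumulative (μ i) φ n (N i)).comp
        (measurable_state C (t + 1))
    rw [Finset.sum_range_succ, add_assoc, ← lintegral_add_right _ hm3]
    have h := lintegral_mpsLaw_round μ C t (f := fun N r =>
      (if i ∈ cache C r then φ (N i) else 0) + cumulative (μ i) φ n (advance C N r i))
      fun N => (hm1 N).add (hm2 N)
    simp only [state]
    rw [h, add_assoc t, add_comm 1 n]
    refine le_trans ?_ (ih (n + 1))
    gcongr with ω
    exact lintegral_charge_add_cumulative_le μ C _ i φ n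

/-- Charging `φ` of the counts of file `i` whenever `i` is cached costs in total no more than if
`i` were cached in every round. -/
lemma sum_lintegral_charge_le (μ : PMF (Fin L)) (C : ℕ) (i : Fin L) (φ : ℕ × ℕ → ℝ≥0∞) (T : ℕ) :
    ∑ s ∈ range T, ∫⁻ ω, (if i ∈ cache C (ω s) then φ (state C ω s i) else 0) ∂mpsLaw μ C ≤
      cumulative (μ i) φ T (0, 0) := by
  simpa using le_self_add.trans (sum_lintegral_add_lintegral_cumulative_le μ C i φ T 0)

lemma cumulative_ofReal (μ : PMF (Fin L)) (i : Fin L) {ψ : ℕ × ℕ → ℝ} (hψ : ∀ m, 0 ≤ ψ m)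
    (T : ℕ) :
    cumulative (μ i) (fun m => ENNReal.ofReal (ψ m)) T (0, 0) =
      ENNReal.ofReal (∑ k ∈ range T, ∑ m ∈ antidiagonal k,
        binomialWeight (μ i).toReal m.1 m.2 * ψ m) := by
  have hq0 : 0 ≤ (μ i).toReal := ENNReal.toReal_nonneg
  have hq1 : (μ i).toReal ≤ 1 := ENNReal.toReal_le_of_le_ofReal zero_le_one (by
    simpa using μ.coe_le_one i)
  have hw (m : ℕ × ℕ) : 0 ≤ binomialWeight (μ i).toReal m.1 m.2 * ψ m :=
    mul_nonneg (binomialWeight_nonneg hq0 hq1 _ _) (hψ m)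
  rw [cumulative, Finset.sum_apply,
    ENNReal.ofReal_sum_of_nonneg fun k _ => Finset.sum_nonneg fun m _ => hw m]
  refine Finset.sum_congr rfl fun k _ => ?_
  rw [observe_pow_apply_zero, ENNReal.ofReal_sum_of_nonneg fun m _ => hw m]
  refine Finset.sum_congr rfl fun m hm => ?_
  rw [HasAntidiagonal.mem_antidiagonal] at hm
  have h1 : 0 ≤ 1 - (μ i).toReal := by linarith
  rw [ENNReal.ofReal_mul (binomialWeight_nonneg hq0 hq1 _ _), binomialWeight, hm,
    ENNReal.ofReal_mul (by positivity), ENNReal.ofReal_mul (by positivity),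
    ENNReal.ofReal_pow hq0, ENNReal.ofReal_pow h1, ENNReal.ofReal_natCast,
    ENNReal.ofReal_sub _ hq0, ENNReal.ofReal_toReal (μ.apply_ne_top i), ENNReal.ofReal_one]

lemma exceed_ratio {y : ℝ} (h0 : 0 < y) (h1 : y < 1) (m : ℕ × ℕ) {s t : ℝ≥0∞}
    (h : betaMeasure (1 + m.1) (1 + m.2) (Set.Ioi y) * s ≤
      betaMeasure (1 + m.1) (1 + m.2) (Set.Iic y) * t) :
    s ≤ ENNReal.ofReal ((exceedProb y m)⁻¹ - 1) * t := by
  have hp := exceedProb_pos h0 h1 m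
  have e1 : betaMeasure (1 + m.1) (1 + m.2) (Set.Ioi y) = ENNReal.ofReal (exceedProb y m) := by
    rw [exceedProb, measureReal_def, ENNReal.ofReal_toReal (measure_ne_top _ _)]
  have e2 : betaMeasure (1 + m.1) (1 + m.2) (Set.Iic y) =
      ENNReal.ofReal (1 - exceedProb y m) := by
    rw [exceedProb, ← probReal_compl_eq_one_sub measurableSet_Ioi, Set.compl_Ioi, measureReal_def,
      ENNReal.ofReal_toReal (measure_ne_top _ _)]
  rw [e1, e2] at h
  have e3 : ENNReal.ofReal ((exceedProb y m)⁻¹ - 1) =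
      (ENNReal.ofReal (exceedProb y m))⁻¹ * ENNReal.ofReal (1 - exceedProb y m) := by
    rw [← ENNReal.ofReal_inv_of_pos hp, ← ENNReal.ofReal_mul (by positivity)]
    congr 1
    field_simp
  rw [e3, mul_assoc]
  have hne : ENNReal.ofReal (exceedProb y m) ≠ 0 := by simpa using hp
  calc s = (ENNReal.ofReal (exceedProb y m))⁻¹ * (ENNReal.ofReal (exceedProb y m) * s) := by
        rw [← mul_assoc, ENNReal.inv_mul_cancel hne ENNReal.ofReal_ne_top, one_mul]
    _ ≤ _ := by gcongr

/-! ### Displaced rounds. -/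

/-- The rounds in which `j` is cached with a small value although `i` is not cached. -/
def displaced (C : ℕ) (i j : Fin L) (y : ℝ) : Set (Round L) :=
  {r | j ∈ topC C r.1 ∧ r.1 j ≤ y ∧ i ∉ topC C r.1}

lemma measurableSet_displaced (C : ℕ) (i j : Fin L) (y : ℝ) :
    MeasurableSet (displaced C i j y) :=
  (measurableSet_mem_cache C j).inter
    ((measurableSet_le ((measurable_pi_apply j).comp measurable_fst) measurable_const).inter
      (measurableSet_mem_cache C i).compl)

lemma roundKernel_fst_preimage (μ : PMF (Fin L)) (N : Fin L → ℕ × ℕ) {S : Set (Fin L → ℝ)}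
    (hS : MeasurableSet S) : roundKernel μ N (Prod.fst ⁻¹' S) = samplingLaw N S := by
  change ((samplingLaw N).prod μ.toMeasure) (Prod.fst ⁻¹' S) = _
  rw [← Measure.map_apply measurable_fst hS, Measure.map_fst_prod]
  simp

lemma roundKernel_displaced_le (μ : PMF (Fin L)) (C : ℕ) (N : Fin L → ℕ × ℕ) (i j : Fin L)
    {y : ℝ} (h0 : 0 < y) (h1 : y < 1) :
    roundKernel μ N (displaced C i j y) ≤
      ENNReal.ofReal ((exceedProb y (N i))⁻¹ - 1) * roundKernel μ N {r | i ∈ cache C r} := by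
  refine exceed_ratio h0 h1 (N i) ?_
  have hE : MeasurableSet {v : Fin L → ℝ | j ∈ topC C v ∧ v j ≤ y ∧ i ∉ topC C v} :=
    (measurableSet_mem_topC C j).inter
      ((measurableSet_le (measurable_pi_apply j) measurable_const).inter
        (measurableSet_mem_topC C i).compl)
  have e1 := roundKernel_fst_preimage μ N hE
  have e2 := roundKernel_fst_preimage μ N (measurableSet_mem_topC C i)
  have h := exceed_mul_samplingLaw_le C N i j y
  rw [← e1, ← e2] at h
  exact h

lemma measure_round_eq_lintegral (μ : PMF (Fin L)) (C t : ℕ) {S : Set (Round L)}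
    (hS : MeasurableSet S) :
    mpsLaw μ C {ω | ω t ∈ S} = ∫⁻ ω, roundKernel μ (state C ω t) S ∂mpsLaw μ C := by
  have h := lintegral_mpsLaw_round μ C t (f := fun _ => S.indicator 1)
    fun _ => measurable_one.indicator hS
  simp only [lintegral_indicator_one hS] at h
  rw [← h]
  exact (lintegral_indicator_one (measurable_pi_apply (X := fun _ => Round L) t hS)).symm

/-- The bound does not depend on `T`: the charge `1/p - 1` falls only on rounds that cache `i`, each
of which adds an observation of `i`. -/
lemma sum_measure_displaced_le (μ : PMF (Fin L)) (C : ℕ) (i j : Fin L) {d y : ℝ} (hd : 0 < d)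
    (hy : d ≤ y) (hyi : y + 2 * d ≤ (μ i).toReal) (T : ℕ) :
    ∑ t ∈ range T, mpsLaw μ C {ω | ω t ∈ displaced C i j y} ≤
      ENNReal.ofReal (∑' k, inverseBound d k) := by
  have hq1 : (μ i).toReal ≤ 1 := ENNReal.toReal_le_of_le_ofReal zero_le_one (by
    simpa using μ.coe_le_one i)
  set φ : ℕ × ℕ → ℝ≥0∞ := fun m => ENNReal.ofReal ((exceedProb y m)⁻¹ - 1)
  have hstep (t : ℕ) : mpsLaw μ C {ω | ω t ∈ displaced C i j y} ≤
      ∫⁻ ω, (if i ∈ cache C (ω t) then φ (state C ω t i) else 0) ∂mpsLaw μ C := by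
    rw [measure_round_eq_lintegral μ C t (measurableSet_displaced C i j y),
      lintegral_mpsLaw_round μ C t (f := fun N r => if i ∈ cache C r then φ (N i) else 0)
        fun N => Measurable.ite (measurableSet_mem_cache C i) measurable_const measurable_const]
    refine lintegral_mono fun ω => ?_
    refine (roundKernel_displaced_le μ C _ i j (by linarith) (by linarith)).trans_eq ?_
    rw [← lintegral_indicator_const (measurableSet_mem_cache C i)]
    exact lintegral_congr fun r => by simp [Set.indicator_apply, φ]
  refine (Finset.sum_le_sum fun t _ => hstep t).trans
    ((sum_lintegral_charge_le μ C i φ T).trans ?_)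
  rw [cumulative_ofReal μ i (ψ := fun m => (exceedProb y m)⁻¹ - 1)]
  · exact ENNReal.ofReal_le_ofReal
      (sum_sum_binomialWeight_mul_inv_exceedProb_le hd hy hyi hq1 T)
  · intro m
    have := (one_le_inv₀ (exceedProb_pos (by linarith) (by linarith) m)).2 (exceedProb_le_one y m)
    linarith

/-! ### Inflated rounds. -/

/-- The rounds in which `j` is cached with a large value. -/
def inflated (C : ℕ) (j : Fin L) (y : ℝ) : Set (Round L) :=
  {r | j ∈ cache C r ∧ y < r.1 j}

lemma measurableSet_exceeds (j : Fin L) (y : ℝ) : MeasurableSet {r : Round L | y < r.1 j} :=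
  measurableSet_lt measurable_const ((measurable_pi_apply j).comp measurable_fst)

lemma roundKernel_exceeds (μ : PMF (Fin L)) (N : Fin L → ℕ × ℕ) (j : Fin L) (y : ℝ) :
    roundKernel μ N {r | y < r.1 j} = betaMeasure (1 + (N j).1) (1 + (N j).2) (Set.Ioi y) := by
  have h := roundKernel_fst_preimage μ N (measurable_pi_apply j (measurableSet_Ioi (a := y)))
  refine h.trans ?_
  rw [← Measure.map_apply (measurable_pi_apply j) measurableSet_Ioi]
  have := (measurePreserving_eval
    (fun i => betaMeasure (1 + ((N i).1 : ℝ)) (1 + ((N i).2 : ℝ))) j).map_eq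
  exact congrArg (fun ν : Measure ℝ => ν (Set.Ioi y)) this

/-- Rounds with exploratory counts are charged to `j`. In the others `j` has at least `M`
observations and empirical mean at most `x`, so its posterior exceeds `y` with probability at most
`c`, proportional to `1 / T`; over `T` rounds this adds a constant. -/
lemma sum_measure_inflated_le (μ : PMF (Fin L)) (C : ℕ) (j : Fin L) {d x y : ℝ} (hd : 0 < d)
    (hd1 : d ≤ 1) (hjx : (μ j).toReal + d ≤ x) (hxy : x + d ≤ y) {T M : ℕ} (hT : 0 < T)
    (hM : 8 / d ^ 2 * Real.log T ≤ M) :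
    ∑ t ∈ range T, mpsLaw μ C {ω | ω t ∈ inflated C j y} ≤
      ENNReal.ofReal (M + ∑' k, tailBound d k + (8 / d ^ 2 + 1)) := by
  have hq0 : 0 ≤ (μ j).toReal := ENNReal.toReal_nonneg
  have hq1 : (μ j).toReal ≤ 1 := ENNReal.toReal_le_of_le_ofReal zero_le_one (by
    simpa using μ.coe_le_one j)
  have hT' : (0 : ℝ) < T := by exact_mod_cast hT
  set φ : ℕ × ℕ → ℝ≥0∞ := fun m => ENNReal.ofReal (exploring M x m)
  set c : ℝ := (8 / d ^ 2 + 1) / T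
  have hstep (t : ℕ) : mpsLaw μ C {ω | ω t ∈ inflated C j y} ≤
      ∫⁻ ω, (if j ∈ cache C (ω t) then φ (state C ω t j) else 0) ∂mpsLaw μ C +
        ENNReal.ofReal c := by
    have hmeas : MeasurableSet (inflated C j y) :=
      (measurableSet_mem_cache C j).inter (measurableSet_exceeds j y)
    rw [measure_round_eq_lintegral μ C t hmeas,
      lintegral_mpsLaw_round μ C t (f := fun N r => if j ∈ cache C r then φ (N j) else 0)
        fun N => Measurable.ite (measurableSet_mem_cache C j) measurable_const measurable_const]
    have hc : ENNReal.ofReal c = ∫⁻ _, ENNReal.ofReal c ∂mpsLaw μ C := by simp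
    rw [hc, ← lintegral_add_right _ measurable_const]
    refine lintegral_mono fun ω => ?_
    set N := state C ω t
    by_cases h : (N j).1 + (N j).2 < M ∨ x * ((N j).1 + (N j).2) < (N j).1
    · refine le_add_right ?_
      have hφ : φ (N j) = 1 := by simp [φ, exploring, h]
      rw [hφ]
      calc roundKernel μ N (inflated C j y) ≤ roundKernel μ N {r | j ∈ cache C r} :=
            measure_mono fun r hr => hr.1
        _ = _ := by
            rw [← lintegral_indicator_one (measurableSet_mem_cache C j)]
            exact lintegral_congr fun r => by simp [Set.indicator_apply]
    · refine le_add_left ?_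
      push Not at h
      calc roundKernel μ N (inflated C j y) ≤ roundKernel μ N {r | y < r.1 j} :=
            measure_mono fun r hr => hr.2
        _ ≤ ENNReal.ofReal (tailBound d ((N j).1 + (N j).2)) := by
            rw [roundKernel_exceeds]
            exact betaMeasure_Ioi_le hd.le hd1 hxy h.2
        _ ≤ ENNReal.ofReal c := by
            refine ENNReal.ofReal_le_ofReal (tailBound_le_of_log_le hd hT' (hM.trans ?_))
            exact_mod_cast h.1
  have hψ (m : ℕ × ℕ) : 0 ≤ exploring M x m := by
    unfold exploring
    split_ifs <;> norm_num
  have hS := sum_binomialWeight_mul_exploring_le hd hd1 hq0 hq1 hjx M T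
  have hS0 : 0 ≤ M + ∑' k, tailBound d k :=
    add_nonneg (by positivity) (tsum_nonneg (tailBound_nonneg d))
  refine (Finset.sum_le_sum fun t _ => hstep t).trans ?_
  rw [Finset.sum_add_distrib, ENNReal.ofReal_add hS0 (by positivity)]
  refine add_le_add ((sum_lintegral_charge_le μ C j φ T).trans ?_) ?_
  · rw [cumulative_ofReal μ j hψ]
    exact ENNReal.ofReal_le_ofReal hS
  · rw [Finset.sum_const, card_range, nsmul_eq_mul, ← ENNReal.ofReal_natCast,
      ← ENNReal.ofReal_mul hT'.le]
    refine ENNReal.ofReal_le_ofReal (le_of_eq ?_)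
    simp only [c]
    field_simp

lemma measurableSet_mem_cache_at (C t : ℕ) (j : Fin L) :
    MeasurableSet {ω : ℕ → Round L | j ∈ cache C (ω t)} :=
  measurable_pi_apply (X := fun _ => Round L) t (measurableSet_mem_cache C j)

/-! ### From cached unpopular files to the regret. -/

/-- The expected number of rounds in which an unpopular file is cached. -/
lemma sum_measure_mem_cache_le (μ : PMF (Fin L)) {C : ℕ} (hCL : C ≤ L) {j : Fin L}
    (hj : C ≤ (j : ℕ)) {d y : ℝ} (hd : 0 < d) (hd1 : d ≤ 1) (hy : (μ j).toReal + 2 * d ≤ y)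
    (hyi : ∀ i : Fin L, (i : ℕ) < C → y + 2 * d ≤ (μ i).toReal) {T M : ℕ} (hT : 0 < T)
    (hM : 8 / d ^ 2 * Real.log T ≤ M) :
    ∑ t ∈ range T, mpsLaw μ C {ω | j ∈ cache C (ω t)} ≤
      ENNReal.ofReal (M + ∑' k, tailBound d k + (8 / d ^ 2 + 1) + C * ∑' k, inverseBound d k) := by
  have hB : 0 ≤ ∑' k, inverseBound d k := tsum_nonneg (inverseBound_nonneg hd)
  have hA : 0 ≤ ∑' k, tailBound d k := tsum_nonneg (tailBound_nonneg d)
  set I : Finset (Fin L) := univ.filter fun i : Fin L => (i : ℕ) < C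
  have hstep (t : ℕ) : mpsLaw μ C {ω | j ∈ cache C (ω t)} ≤
      mpsLaw μ C {ω | ω t ∈ inflated C j y} +
        ∑ i ∈ I, mpsLaw μ C {ω | ω t ∈ displaced C i j y} := by
    calc _ ≤ mpsLaw μ C ({ω | ω t ∈ inflated C j y} ∪
          ⋃ i ∈ I, {ω | ω t ∈ displaced C i j y}) := by
          refine measure_mono fun ω hω => ?_
          rcases lt_or_ge y ((ω t).1 j) with h | h
          · exact Or.inl ⟨hω, h⟩
          · obtain ⟨i, hi, hiC⟩ := exists_lt_notMem_topC hCL hj hω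
            exact Or.inr (Set.mem_biUnion (x := i) (by simpa [I] using hiC) ⟨hω, h, hi⟩)
      _ ≤ _ := (measure_union_le _ _).trans
          (add_le_add le_rfl (measure_biUnion_finset_le _ _))
  refine (Finset.sum_le_sum fun t _ => hstep t).trans ?_
  rw [Finset.sum_add_distrib, Finset.sum_comm,
    ENNReal.ofReal_add (by positivity) (by positivity)]
  have hj0 : 0 ≤ (μ j).toReal := ENNReal.toReal_nonneg
  refine add_le_add (sum_measure_inflated_le μ C j (x := (μ j).toReal + d) hd hd1 le_rfl
    (by linarith) hT hM) ?_
  calc _ ≤ ∑ i ∈ I, ENNReal.ofReal (∑' k, inverseBound d k) :=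
        Finset.sum_le_sum fun i hi => sum_measure_displaced_le μ C i j hd (by linarith)
          (hyi i (by simpa [I] using hi)) T
    _ = _ := by
        rw [Finset.sum_const, card_filter_val_lt hCL, nsmul_eq_mul,
          ENNReal.ofReal_mul (by positivity), ENNReal.ofReal_natCast]

lemma regret_le (C : ℕ) (hCL : C ≤ L) (T : ℕ) (ω : ℕ → Round L) :
    regret C T ω ≤ ∑ t ∈ range T, ∑ j ∈ univ.filter (fun j : Fin L => C ≤ (j : ℕ)),
      {ω : ℕ → Round L | j ∈ cache C (ω t)}.indicator 1 ω := by
  refine Finset.sum_le_sum fun t _ => ?_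
  have hnn (j : Fin L) : (0 : ℝ) ≤ {ω : ℕ → Round L | j ∈ cache C (ω t)}.indicator 1 ω :=
    Set.indicator_nonneg (fun _ _ => zero_le_one) _
  -- Only a request for a popular file that is not cached gives a positive increment; the cache,
  -- having `C` elements, then holds an unpopular file.
  by_cases h : ((ω t).2 : ℕ) < C ∧ (ω t).2 ∉ cache C (ω t)
  · obtain ⟨j, hj, hjC⟩ := exists_le_mem_topC hCL h.1 h.2
    rw [if_pos h.1, if_neg h.2, sub_zero]
    refine le_trans ?_ (Finset.single_le_sum (fun j _ => hnn j) (a := j) (by simpa using hjC))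
    rw [Set.indicator_of_mem (by exact hj)]
    rfl
  · refine le_trans ?_ (Finset.sum_nonneg fun j _ => hnn j)
    split_ifs <;> first | (norm_num; done) | tauto

lemma measurableSet_hit (C : ℕ) : MeasurableSet {r : Round L | r.2 ∈ cache C r} := by
  have : {r : Round L | r.2 ∈ cache C r} = ⋃ i, {r | i ∈ cache C r} ∩ {r | r.2 = i} := by
    ext r
    simp
  rw [this]
  exact MeasurableSet.iUnion fun i =>
    (measurableSet_mem_cache C i).inter (measurableSet_requested i)

lemma integrable_regret (μ : PMF (Fin L)) (C T : ℕ) : Integrable (regret C T) (mpsLaw μ C) := by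
  unfold regret
  refine integrable_finsetSum _ fun t _ => Integrable.sub ?_ ?_
  · have h : Measurable fun r : Round L => if (r.2 : ℕ) < C then (1 : ℝ) else 0 :=
      (measurable_of_countable fun x : Fin L => if (x : ℕ) < C then (1 : ℝ) else 0).comp
        measurable_snd
    refine Integrable.of_bound (h.comp (measurable_pi_apply t)).aestronglyMeasurable 1
      (Filter.Eventually.of_forall fun ω => ?_)
    split_ifs <;> simp
  · have h : Measurable fun r : Round L => if r.2 ∈ cache C r then (1 : ℝ) else 0 :=
      Measurable.ite (measurableSet_hit C) measurable_const measurable_const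
    refine Integrable.of_bound (h.comp (measurable_pi_apply t)).aestronglyMeasurable 1
      (Filter.Eventually.of_forall fun ω => ?_)
    split_ifs <;> simp

lemma integral_regret_le (μ : PMF (Fin L)) (C : ℕ) (hCL : C ≤ L) (T : ℕ) {B : ℝ} (hB : 0 ≤ B)
    (h : ∀ j : Fin L, C ≤ (j : ℕ) →
      ∑ t ∈ range T, mpsLaw μ C {ω | j ∈ cache C (ω t)} ≤ ENNReal.ofReal B) :
    ∫ ω, regret C T ω ∂mpsLaw μ C ≤ ((L : ℝ) - C) * B := by
  have hint (t : ℕ) (j : Fin L) : Integrable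
      ({ω : ℕ → Round L | j ∈ cache C (ω t)}.indicator (1 : (ℕ → Round L) → ℝ)) (mpsLaw μ C) :=
    (integrable_const (1 : ℝ)).indicator (measurableSet_mem_cache_at C t j)
  calc ∫ ω, regret C T ω ∂mpsLaw μ C
      ≤ ∫ ω, ∑ t ∈ range T, ∑ j ∈ univ.filter (fun j : Fin L => C ≤ (j : ℕ)),
          {ω : ℕ → Round L | j ∈ cache C (ω t)}.indicator 1 ω ∂mpsLaw μ C :=
        integral_mono (integrable_regret μ C T)
          (integrable_finsetSum _ fun t _ => integrable_finsetSum _ fun j _ => hint t j)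
          (regret_le C hCL T)
    _ = ∑ j ∈ univ.filter (fun j : Fin L => C ≤ (j : ℕ)), ∑ t ∈ range T,
          (mpsLaw μ C).real {ω | j ∈ cache C (ω t)} := by
        rw [integral_finsetSum _ fun t _ => integrable_finsetSum _ fun j _ => hint t j,
          Finset.sum_comm]
        refine Finset.sum_congr rfl fun t _ => ?_
        rw [integral_finsetSum _ fun j _ => hint t j]
        refine Finset.sum_congr rfl fun j _ => ?_
        rw [integral_indicator_one (measurableSet_mem_cache_at C t j)]
    _ ≤ ∑ j ∈ univ.filter (fun j : Fin L => C ≤ (j : ℕ)), B := by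
        refine Finset.sum_le_sum fun j hj => ?_
        have h1 := ENNReal.toReal_le_of_le_ofReal hB (h j (by simpa using hj))
        rwa [ENNReal.toReal_sum fun t _ => measure_ne_top _ _] at h1
    _ = ((L : ℝ) - C) * B := by
        have hcard : (univ.filter (fun j : Fin L => C ≤ (j : ℕ))).card = L - C := by
          have h1 := Finset.card_filter_add_card_filter_not (s := (univ : Finset (Fin L)))
            (fun j : Fin L => (j : ℕ) < C)
          simp only [not_lt] at h1
          rw [card_filter_val_lt hCL, card_univ, Fintype.card_fin] at h1
          omega
        rw [Finset.sum_const, hcard, nsmul_eq_mul, Nat.cast_sub hCL]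

/-- The constant in the regret bound, as a function of a quarter of the gap. -/
def regretConst (d : ℝ) : ℝ :=
  8 / d ^ 2 + (2 + ∑' k, tailBound d k + 8 / d ^ 2 + ∑' k, inverseBound d k) / Real.log 2

lemma rate_le_regretConst {d : ℝ} (hd : 0 < d) {C T M : ℕ} (hC : 0 < C) (hT : 2 ≤ T)
    (hM : (M : ℝ) ≤ 8 / d ^ 2 * Real.log T + 1) :
    M + ∑' k, tailBound d k + (8 / d ^ 2 + 1) + C * ∑' k, inverseBound d k ≤
      regretConst d * (C * Real.log T) := by
  have hB : 0 ≤ ∑' k, inverseBound d k := tsum_nonneg (inverseBound_nonneg hd)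
  have hA : 0 ≤ ∑' k, tailBound d k := tsum_nonneg (tailBound_nonneg d)
  unfold regretConst
  set A := ∑' k, tailBound d k
  set B := ∑' k, inverseBound d k
  set r := 8 / d ^ 2
  have hr : 0 ≤ r := by positivity
  have hC' : (1 : ℝ) ≤ C := by exact_mod_cast hC
  have h2 : 0 < Real.log 2 := Real.log_pos (by norm_num)
  have hlog : Real.log 2 ≤ Real.log T := Real.log_le_log (by norm_num) (by exact_mod_cast hT)
  -- Constants are absorbed into `log T` because `T ≥ 2`; the `2` collects the rounding in `M` and
  -- the `1` in `8 / d ^ 2 + 1`.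
  have h3 : 2 + A + r + B ≤ (2 + A + r + B) / Real.log 2 * Real.log T := by
    rw [div_mul_eq_mul_div, le_div_iff₀ h2]
    gcongr
  calc M + A + (r + 1) + C * B ≤ r * Real.log T + 1 + A + (r + 1) + C * B := by gcongr
    _ ≤ C * (r * Real.log T) + C * (2 + A + r + B) := by
        have : 0 ≤ r * Real.log T := by positivity
        nlinarith
    _ ≤ C * (r * Real.log T) + C * ((2 + A + r + B) / Real.log 2 * Real.log T) := by gcongr
    _ = _ := by ring

end Caching

end

theorem mainTheorem5 :
    ∃ K : ℝ → ℝ, ∀ (L C : ℕ) (_hC : 0 < C) (hCL : C < L) (μ : PMF (Fin L)) (_hμ : StrictAnti μ)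
      (T : ℕ) (_hT : 2 ≤ T),
      MeasureTheory.Integrable (Caching.regret C T) (Caching.mpsLaw μ C) ∧
      ∫ ω, Caching.regret C T ω ∂(Caching.mpsLaw μ C) ≤
        K (Caching.gap μ C hCL) * (((L : ℝ) - C) * C * Real.log T) := by
  refine ⟨fun g => Caching.regretConst (g / 4), fun L C hC hCL μ hμ T hT =>
    ⟨Caching.integrable_regret μ C T, ?_⟩⟩
  -- Four margins of size `d` are needed: from `μ j` to the bound `x` on the empirical mean of `j`,
  -- from `x` to `y`, from `y` to the split point `y + d` for file `i`, and from there to `μ i`.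
  set d := Caching.gap μ C hCL / 4 with hd_def
  have mono {i j : Fin L} (hij : i ≤ j) : (μ j).toReal ≤ (μ i).toReal :=
    ENNReal.toReal_mono (μ.apply_ne_top i) (hμ.antitone hij)
  have hgap : (μ ⟨C, hCL⟩).toReal + 4 * d = (μ ⟨C - 1, by omega⟩).toReal := by
    rw [hd_def, Caching.gap]
    ring
  have hd : 0 < d := by
    have hlt : μ ⟨C, hCL⟩ < μ ⟨C - 1, by omega⟩ := hμ (by
      rw [Fin.mk_lt_mk]
      omega)
    have := ENNReal.toReal_strict_mono (μ.apply_ne_top _) hlt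
    linarith
  have hd1 : d ≤ 1 := by
    have h1 : (μ ⟨C - 1, by omega⟩).toReal ≤ 1 :=
      ENNReal.toReal_le_of_le_ofReal zero_le_one (by simpa using μ.coe_le_one _)
    have h0 : 0 ≤ (μ ⟨C, hCL⟩).toReal := ENNReal.toReal_nonneg
    linarith
  set M := ⌈8 / d ^ 2 * Real.log T⌉₊
  have hlog : 0 ≤ Real.log T := Real.log_natCast_nonneg T
  have hM : 8 / d ^ 2 * Real.log T ≤ M := Nat.le_ceil _
  have hM' : (M : ℝ) ≤ 8 / d ^ 2 * Real.log T + 1 := (Nat.ceil_lt_add_one (by positivity)).le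
  have hrate := Caching.rate_le_regretConst hd hC hT hM'
  have hB : 0 ≤ ∑' k, Caching.inverseBound d k := tsum_nonneg (Caching.inverseBound_nonneg hd)
  have hA : 0 ≤ ∑' k, Caching.tailBound d k := tsum_nonneg (Caching.tailBound_nonneg d)
  refine (Caching.integral_regret_le μ C hCL.le T
    (B := Caching.regretConst d * (C * Real.log T)) (le_trans (by positivity) hrate)
    fun j hj => ?_).trans_eq (by ring)
  refine (Caching.sum_measure_mem_cache_le μ hCL.le hj (y := (μ ⟨C, hCL⟩).toReal + 2 * d) hd hd1
    ?_ ?_ (by omega) hM).trans (ENNReal.ofReal_le_ofReal hrate)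
  · have := mono (i := ⟨C, hCL⟩) (j := j) hj
    linarith
  · intro i hi
    have := mono (i := i) (j := ⟨C - 1, by omega⟩) (by rw [Fin.le_def]; simp only; omega)
    linarith
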